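/- All Banach spaces are over a fixed scalar field $\mathbb K\in\{\mathbb R,\mathbb C\}$; $E'$ and $E''$ denote the dual and the bidual of $E$, $j_E:E\to E''$ is the canonical embedding, $\mathcal L(E,F)$ is the space of bounded operators and $\mathcal F(E,F)$ the space of those of finite rank. A Banach ideal $(\mathcal A,\mathbf A)$ is a Banach operator ideal in the sense of Pietsch: every component $\mathcal A(E,F)\subseteq\mathcal L(E,F)$ is a linear space, complete under the norm $\mathbf A$; rank one operators $a\otimes y$ belong to it and $\mathbf A(a\otimes y)=\|a\|\,\|y\|$; and $RST\in\mathcal A$ with $\mathbf A(RST)\le\|R\|\,\mathbf A(S)\,\|T\|$ whenever $S\in\mathcal A$ and $R,T$ are bounded. Maximality: $(\mathcal A,\mathbf A)$ is maximal if it coincides isometrically with its maximal hull, the two-sided quotient $\overline{\mathcal F}^{-1}\circ\mathcal A\circ\overline{\mathcal F}^{-1}$ by the ideal $\overline{\mathcal F}$ of approximable operators (operator norm limits of finite rank operators): it consists of the $T$ such that $RTS\in\mathcal A$ for all composable approximable $R,S$, with norm $\sup\{\mathbf A(RTS):R,S \text{ approximable},\ \|R\|=\|S\|=1\}$. Adjoint: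 $T\in\mathcal L(E,F)$ belongs to $\mathcal A^*(E,F)$ if there is $c\ge 0$ such that $|\operatorname{tr}(TBSR)|\le c\,\|B\|\,\mathbf A(S)\,\|R\|$ for all Banach spaces $E_0,F_0$ and all $B\in\mathcal F(E_0,E)$, $S\in\mathcal A(F_0,E_0)$, $R\in\mathcal F(F,F_0)$; $\mathbf A^*(T)$ is the infimum of these $c$. Write $\mathcal A^{**}=(\mathcal A^*)^*$ and $\mathcal A^{***}=(\mathcal A^{**})^*$, and similarly for the norms. Extension property: $(\mathcal A,\mathbf A)$ has the $\mathcal A$-extension property if for every $\varepsilon>0$, every linear isometric embedding $J:E\to G$ of Banach spaces and every $T\in\mathcal A(E,F)$ there is $\tilde T\in\mathcal A(G,F)$ with $T=\tilde TJ$ and $\mathbf A(\tilde T)\le(1+\varepsilon)\,\mathbf A(T)$. **Corollary 4.1.** Let $(\mathcal A,\mathbf A)$ be a maximal Banach ideal with the $\mathcal A$-extension property. Then the principle of $\mathcal A^*$-local reflexivity holds: for every finite-dimensional normed space $M$, every Banach space $F$, every finite-dimensional subspace $N\subseteq F'$, every $T\in\mathcal L(M,F'')$ and every $\varepsilon>0$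 there is $S\in\mathcal A^*(M,F)$ such that 1. $\mathbf A^*(S)\le(1+\varepsilon)\,\mathbf A^{***}(T)$; 2. $\langle Sx,b\rangle=\langle b,Tx\rangle$ for all $x\in M$, $b\in N$; 3. $j_F(Sx)=Tx$ for all $x\in M$ with $Tx\in j_F(F)$. Moreover, the same holds with (1) replaced by $\mathbf A^*(S)\le(1+\varepsilon)\,\mathbf A^*(T)$; that is, in the norm estimate of the classical principle of local reflexivity the operator norm may be replaced by the adjoint ideal norm $\mathbf A^*$. -/

import Mathlib

open Filter Topology

universe u

noncomputable section

/-- A class of bounded operators between Banach spaces over `𝕜`, together with a size function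
on it: for every pair of Banach spaces `E`, `F`, a set of operators `E → F` (the component of the
class at `(E, F)`) and a real number for each operator.  The value of `norm` at operators which do
not belong to the class is irrelevant.  No laws are imposed here: they are collected in
`OpClass.IsBanachIdeal`. -/
structure OpClass (𝕜 : Type) [RCLike 𝕜] where
  mem : ∀ {E F : Type u} [NormedAddCommGroup E] [NormedSpace 𝕜 E] [CompleteSpace E]
    [NormedAddCommGroup F] [NormedSpace 𝕜 F] [CompleteSpace F], (E →L[𝕜] F) → Prop
  norm : ∀ {E F : Type u} [NormedAddCommGroup E] [NormedSpace 𝕜 E] [CompleteSpace E]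
    [NormedAddCommGroup F] [NormedSpace 𝕜 F] [CompleteSpace F], (E →L[𝕜] F) → ℝ

/-- `T` is a finite operator: its range is finite-dimensional. -/
def FiniteRank {𝕜 : Type} [RCLike 𝕜] {E F : Type u} [NormedAddCommGroup E] [NormedSpace 𝕜 E]
    [NormedAddCommGroup F] [NormedSpace 𝕜 F] (T : E →L[𝕜] F) : Prop :=
  FiniteDimensional 𝕜 (LinearMap.range (T : E →ₗ[𝕜] F))

/-- The trace of a finite rank operator `U` on a (possibly infinite-dimensional) space: the trace
of the endomorphism which `U` induces on its (finite-dimensional) range. -/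
def finTrace {𝕜 : Type} [RCLike 𝕜] {E : Type u} [NormedAddCommGroup E] [NormedSpace 𝕜 E]
    (U : E →L[𝕜] E) : 𝕜 :=
  LinearMap.trace 𝕜 (LinearMap.range (U : E →ₗ[𝕜] E))
    ((U : E →ₗ[𝕜] E).rangeRestrict ∘ₗ (LinearMap.range (U : E →ₗ[𝕜] E)).subtype)

namespace OpClass

/-- A Banach (operator) ideal: every component is a linear space containing the rank one
operators `x ↦ a x • y`, on which `norm` is a complete norm, normalised by `‖a‖ * ‖y‖` on rank one
operators, and `R ∘ S ∘ T` belongs to the class, with norm at most `‖R‖ * norm S * ‖T‖`,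
whenever `S` does. -/
structure IsBanachIdeal {𝕜 : Type} [RCLike 𝕜] (A : OpClass.{u} 𝕜) : Prop where
  add_mem : ∀ {E F : Type u} [NormedAddCommGroup E] [NormedSpace 𝕜 E] [CompleteSpace E]
    [NormedAddCommGroup F] [NormedSpace 𝕜 F] [CompleteSpace F] (S T : E →L[𝕜] F),
    A.mem S → A.mem T → A.mem (S + T)
  smul_mem : ∀ {E F : Type u} [NormedAddCommGroup E] [NormedSpace 𝕜 E] [CompleteSpace E]
    [NormedAddCommGroup F] [NormedSpace 𝕜 F] [CompleteSpace F] (c : 𝕜) (T : E →L[𝕜] F),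
    A.mem T → A.mem (c • T)
  norm_add_le : ∀ {E F : Type u} [NormedAddCommGroup E] [NormedSpace 𝕜 E] [CompleteSpace E]
    [NormedAddCommGroup F] [NormedSpace 𝕜 F] [CompleteSpace F] (S T : E →L[𝕜] F),
    A.mem S → A.mem T → A.norm (S + T) ≤ A.norm S + A.norm T
  norm_smul : ∀ {E F : Type u} [NormedAddCommGroup E] [NormedSpace 𝕜 E] [CompleteSpace E]
    [NormedAddCommGroup F] [NormedSpace 𝕜 F] [CompleteSpace F] (c : 𝕜) (T : E →L[𝕜] F),
    A.mem T → A.norm (c • T) = ‖c‖ * A.norm T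
  eq_zero_of_norm : ∀ {E F : Type u} [NormedAddCommGroup E] [NormedSpace 𝕜 E] [CompleteSpace E]
    [NormedAddCommGroup F] [NormedSpace 𝕜 F] [CompleteSpace F] (T : E →L[𝕜] F),
    A.mem T → A.norm T = 0 → T = 0
  rankOne_mem : ∀ {E F : Type u} [NormedAddCommGroup E] [NormedSpace 𝕜 E] [CompleteSpace E]
    [NormedAddCommGroup F] [NormedSpace 𝕜 F] [CompleteSpace F] (a : StrongDual 𝕜 E) (y : F),
    A.mem (ContinuousLinearMap.smulRight a y)
  norm_rankOne : ∀ {E F : Type u} [NormedAddCommGroup E] [NormedSpace 𝕜 E] [CompleteSpace E]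
    [NormedAddCommGroup F] [NormedSpace 𝕜 F] [CompleteSpace F] (a : StrongDual 𝕜 E) (y : F),
    A.norm (ContinuousLinearMap.smulRight a y) = ‖a‖ * ‖y‖
  comp_mem : ∀ {D E F G : Type u} [NormedAddCommGroup D] [NormedSpace 𝕜 D] [CompleteSpace D]
    [NormedAddCommGroup E] [NormedSpace 𝕜 E] [CompleteSpace E]
    [NormedAddCommGroup F] [NormedSpace 𝕜 F] [CompleteSpace F]
    [NormedAddCommGroup G] [NormedSpace 𝕜 G] [CompleteSpace G]
    (R : F →L[𝕜] G) (S : E →L[𝕜] F) (T : D →L[𝕜] E),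
    A.mem S → A.mem (R ∘L S ∘L T)
  norm_comp_le : ∀ {D E F G : Type u} [NormedAddCommGroup D] [NormedSpace 𝕜 D] [CompleteSpace D]
    [NormedAddCommGroup E] [NormedSpace 𝕜 E] [CompleteSpace E]
    [NormedAddCommGroup F] [NormedSpace 𝕜 F] [CompleteSpace F]
    [NormedAddCommGroup G] [NormedSpace 𝕜 G] [CompleteSpace G]
    (R : F →L[𝕜] G) (S : E →L[𝕜] F) (T : D →L[𝕜] E),
    A.mem S → A.norm (R ∘L S ∘L T) ≤ ‖R‖ * A.norm S * ‖T‖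
  complete : ∀ {E F : Type u} [NormedAddCommGroup E] [NormedSpace 𝕜 E] [CompleteSpace E]
    [NormedAddCommGroup F] [NormedSpace 𝕜 F] [CompleteSpace F] (T : ℕ → E →L[𝕜] F),
    (∀ n, A.mem (T n)) →
    (∀ ε : ℝ, 0 < ε → ∃ n₀ : ℕ, ∀ m n : ℕ, n₀ ≤ m → n₀ ≤ n → A.norm (T m - T n) < ε) →
    ∃ S : E →L[𝕜] F, A.mem S ∧ Tendsto (fun n => A.norm (T n - S)) atTop (𝓝 0)

/-- The isometric identity of two classes: they have the same members, on which the two norms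
agree. -/
def IsometricEq {𝕜 : Type} [RCLike 𝕜] (A B : OpClass.{u} 𝕜) : Prop :=
  ∀ {E F : Type u} [NormedAddCommGroup E] [NormedSpace 𝕜 E] [CompleteSpace E]
    [NormedAddCommGroup F] [NormedSpace 𝕜 F] [CompleteSpace F] (T : E →L[𝕜] F),
    (A.mem T ↔ B.mem T) ∧ (A.mem T → A.norm T = B.norm T)

/-- The approximable operators: the operator norm closure of the finite operators, with the
operator norm. -/
def approximable (𝕜 : Type) [RCLike 𝕜] : OpClass.{u} 𝕜 where
  mem := fun {E F} _ _ _ _ _ _ T => T ∈ closure {S : E →L[𝕜] F | FiniteRank S}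
  norm := fun T => ‖T‖

/-- The right `B`-quotient `A ∘ B⁻¹`: all `T` with `T ∘ S` in `A` for every `S` in `B`, normed by
the supremum of `A (T ∘ S)` over the `S` with `B S = 1`.  (For Banach ideals `A`, `B` this supremum
is finite whenever `T` belongs to the quotient.) -/
def rightQuotient {𝕜 : Type} [RCLike 𝕜] (A B : OpClass.{u} 𝕜) : OpClass.{u} 𝕜 where
  mem := fun {E _} _ _ _ _ _ _ T =>
    ∀ (G : Type u) [NormedAddCommGroup G] [NormedSpace 𝕜 G] [CompleteSpace G] (S : G →L[𝕜] E),
      B.mem S → A.mem (T ∘L S)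
  norm := fun {E _} _ _ _ _ _ _ T =>
    sSup {r : ℝ | ∃ (G : Type u) (_ : NormedAddCommGroup G) (_ : NormedSpace 𝕜 G)
      (_ : CompleteSpace G) (S : G →L[𝕜] E), B.mem S ∧ B.norm S = 1 ∧ r = A.norm (T ∘L S)}

/-- The left `B`-quotient `B⁻¹ ∘ A`: all `T` with `S ∘ T` in `A` for every `S` in `B`, normed by
the supremum of `A (S ∘ T)` over the `S` with `B S = 1`.  (For Banach ideals `A`, `B` this supremum
is finite whenever `T` belongs to the quotient.) -/
def leftQuotient {𝕜 : Type} [RCLike 𝕜] (B A : OpClass.{u} 𝕜) : OpClass.{u} 𝕜 where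
  mem := fun {_ F} _ _ _ _ _ _ T =>
    ∀ (G : Type u) [NormedAddCommGroup G] [NormedSpace 𝕜 G] [CompleteSpace G] (S : F →L[𝕜] G),
      B.mem S → A.mem (S ∘L T)
  norm := fun {_ F} _ _ _ _ _ _ T =>
    sSup {r : ℝ | ∃ (G : Type u) (_ : NormedAddCommGroup G) (_ : NormedSpace 𝕜 G)
      (_ : CompleteSpace G) (S : F →L[𝕜] G), B.mem S ∧ B.norm S = 1 ∧ r = A.norm (S ∘L T)}

/-- The maximal hull of `A`: the two-sided quotient of `A` by the approximable operators. -/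
def maximalHull {𝕜 : Type} [RCLike 𝕜] (A : OpClass.{u} 𝕜) : OpClass.{u} 𝕜 :=
  leftQuotient (approximable 𝕜) (rightQuotient A (approximable 𝕜))

/-- `A` is maximal if it coincides isometrically with its maximal hull. -/
def IsMaximal {𝕜 : Type} [RCLike 𝕜] (A : OpClass.{u} 𝕜) : Prop :=
  A.IsometricEq A.maximalHull

/-- The constants `c ≥ 0` admissible in the definition of the adjoint of `A` at `T : E → F`:
`|tr (T B S R)| ≤ c * ‖B‖ * A(S) * ‖R‖` for all finite `B : E₀ → E`, all `S : F₀ → E₀` in `A` and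
all finite `R : F → F₀`. -/
def adjointConstants {𝕜 : Type} [RCLike 𝕜] (A : OpClass.{u} 𝕜) {E F : Type u}
    [NormedAddCommGroup E] [NormedSpace 𝕜 E] [NormedAddCommGroup F] [NormedSpace 𝕜 F]
    (T : E →L[𝕜] F) : Set ℝ :=
  {c : ℝ | 0 ≤ c ∧ ∀ (E₀ F₀ : Type u)
    [NormedAddCommGroup E₀] [NormedSpace 𝕜 E₀] [CompleteSpace E₀]
    [NormedAddCommGroup F₀] [NormedSpace 𝕜 F₀] [CompleteSpace F₀]
    (B : E₀ →L[𝕜] E) (S : F₀ →L[𝕜] E₀) (R : F →L[𝕜] F₀),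
    FiniteRank B → A.mem S → FiniteRank R →
      ‖finTrace (T ∘L B ∘L S ∘L R)‖ ≤ c * ‖B‖ * A.norm S * ‖R‖}

/-- The adjoint `A*` of `A`. -/
def adjoint {𝕜 : Type} [RCLike 𝕜] (A : OpClass.{u} 𝕜) : OpClass.{u} 𝕜 where
  mem := fun T => (A.adjointConstants T).Nonempty
  norm := fun T => sInf (A.adjointConstants T)

/-- The `A`-extension property: operators in `A` extend along metric injections, with almost the
same `A`-norm. -/
def HasExtensionProperty {𝕜 : Type} [RCLike 𝕜] (A : OpClass.{u} 𝕜) : Prop :=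
  ∀ (ε : ℝ), 0 < ε → ∀ (E F G : Type u)
    [NormedAddCommGroup E] [NormedSpace 𝕜 E] [CompleteSpace E]
    [NormedAddCommGroup F] [NormedSpace 𝕜 F] [CompleteSpace F]
    [NormedAddCommGroup G] [NormedSpace 𝕜 G] [CompleteSpace G]
    (J : E →ₗᵢ[𝕜] G) (T : E →L[𝕜] F), A.mem T →
    ∃ T' : G →L[𝕜] F, A.mem T' ∧ T = T' ∘L J.toContinuousLinearMap ∧
      A.norm T' ≤ (1 + ε) * A.norm T

/-- Local reflexivity with the norm estimate `A(S) ≤ (1 + ε) * B(T)`: for every finite-dimensional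
`M`, every Banach space `F`, every `T : M → F''`, every finite-dimensional subspace `N` of `F'` and
every `ε > 0` there is `S : M → F` satisfying this estimate, with `⟨S x, b⟩ = ⟨b, T x⟩` for `x ∈ M`
and `b ∈ N`, and with `S x = T x` (in `F''`) whenever `T x` lies in the canonical image of `F`. -/
def LocalReflexivityWith {𝕜 : Type} [RCLike 𝕜] (A B : OpClass.{u} 𝕜) : Prop :=
  ∀ (M F : Type u) [NormedAddCommGroup M] [NormedSpace 𝕜 M] [CompleteSpace M]
    [FiniteDimensional 𝕜 M] [NormedAddCommGroup F] [NormedSpace 𝕜 F] [CompleteSpace F]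
    (N : Submodule 𝕜 (StrongDual 𝕜 F)) [FiniteDimensional 𝕜 N]
    (T : M →L[𝕜] StrongDual 𝕜 (StrongDual 𝕜 F)) (ε : ℝ), 0 < ε →
    ∃ S : M →L[𝕜] F, A.mem S ∧ A.norm S ≤ (1 + ε) * B.norm (E := M) (F := StrongDual 𝕜 (StrongDual 𝕜 F)) T ∧
      (∀ x : M, ∀ b ∈ N, b (S x) = T x b) ∧
      (∀ x : M, T x ∈ Set.range (NormedSpace.inclusionInDoubleDual 𝕜 F) →
        NormedSpace.inclusionInDoubleDual 𝕜 F (S x) = T x)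

/-- The principle of `A`-local reflexivity (`A`-LRP): local reflexivity holds with the estimate
`A(S) ≤ (1 + ε) * A**(T)`. -/
def LRP {𝕜 : Type} [RCLike 𝕜] (A : OpClass.{u} 𝕜) : Prop :=
  A.LocalReflexivityWith A.adjoint.adjoint

end OpClass

end

/-!
Fix `T : M → F''`. By the Hahn–Banach theorem, an operator `S : M → F` that reflects `T` on `N` and
has `A*`-norm barely above `A*(T)` exists unless some trace functional `S ↦ tr (V S)`, with
`V : F → M` of norm at most one against the `A*`-norm, is larger than `A*(T)` at `T`, that is
`|tr (V'' T)| > A*(T)` for the extension `V'' : F'' → M`. The same argument with the operator norm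
and its dual, the nuclear norm, is the classical principle of local reflexivity.

Trace duality between the finite-dimensional components of `A` and `A*`, together with maximality,
gives `A(V) ≤ 1`. On the finite-dimensional range `H ⊆ F''` of `T`, classical local reflexivity
replaces `V''` by `V L` with `L : H → F` of norm close to one, so that `A(V''|H)` is barely above
`A(V)`. Finitely many functionals on `F''` embed `H` almost isometrically into some `ℓ∞ⁿ`, and the
extension property extends `V''|H` to `ℓ∞ⁿ`, almost preserving its norm. The definition of `A*`
then yields `|tr (V'' T)| ≤ A*(T) A(V) ≤ A*(T)`. Finally `A* ≤ A***`, since the trace is cyclic.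
-/

set_option maxSynthPendingDepth 3

noncomputable section

section FunctionalAnalysis

variable {𝕜 : Type*} [RCLike 𝕜]

theorem le_of_forall_one_lt_le_pow_mul {a b : ℝ} (n : ℕ) (h : ∀ C > 1, a ≤ C ^ n * b) :
    a ≤ b := by
  have hlim : Tendsto (fun C : ℝ => C ^ n * b) (𝓝[>] 1) (𝓝 (1 ^ n * b)) :=
    (Continuous.tendsto (by fun_prop) 1).mono_left nhdsWithin_le_nhds
  simpa only [one_pow, one_mul] using ge_of_tendsto hlim (eventually_mem_nhdsWithin.mono h)

theorem exists_dual_eq_of_forall_le_seminorm_add {X : Type*} [AddCommGroup X] [Module 𝕜 X]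
    (p : Seminorm 𝕜 X) (Y : Submodule 𝕜 X) (x₀ : X) {c : ℝ} (hc : 0 ≤ c)
    (h : ∀ y ∈ Y, c ≤ p (x₀ + y)) :
    ∃ f : Module.Dual 𝕜 X, (∀ x, ‖f x‖ ≤ p x) ∧ (∀ y ∈ Y, f y = 0) ∧ f x₀ = (c : 𝕜) := by
  rcases hc.eq_or_lt with rfl | hc
  · exact ⟨0, fun x => by simp, fun _ _ => rfl, by simp⟩
  have hx₀ : x₀ ∉ Y := fun hx => hc.not_ge (by simpa using h (-x₀) (Y.neg_mem hx))
  obtain ⟨g, hg₀, hgY⟩ := Submodule.exists_le_ker_of_notMem hx₀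
  set f₀ : Module.Dual 𝕜 X := ((c : 𝕜) / g x₀) • g
  have hf₀Y : ∀ y ∈ Y, f₀ y = 0 := fun y hy => by
    rw [LinearMap.smul_apply, LinearMap.mem_ker.1 (hgY hy), smul_zero]
  have hf₀x₀ : f₀ x₀ = c := div_mul_cancel₀ _ hg₀
  have hbound : ∀ x : (Y ⊔ 𝕜 ∙ x₀ : Submodule 𝕜 X), ‖f₀.domRestrict _ x‖ ≤ p x := by
    rintro ⟨x, hx⟩
    obtain ⟨y, hy, z, hz, rfl⟩ := Submodule.mem_sup.1 hx
    obtain ⟨a, rfl⟩ := Submodule.mem_span_singleton.1 hz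
    rcases eq_or_ne a 0 with rfl | ha
    · simp [hf₀Y y hy]
    calc ‖f₀ (y + a • x₀)‖ = ‖a‖ * c := by
          rw [map_add, hf₀Y y hy, zero_add, map_smul, hf₀x₀, norm_smul, RCLike.norm_ofReal,
            abs_of_pos hc]
      _ ≤ ‖a‖ * p (x₀ + a⁻¹ • y) := by gcongr; exact h _ (Y.smul_mem _ hy)
      _ = p (y + a • x₀) := by
          rw [← map_smul_eq_mul, smul_add, smul_inv_smul₀ ha, add_comm]
  obtain ⟨f, hf, hfp⟩ := Module.Dual.exists_extension_of_le_seminorm _ _ hbound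
  refine ⟨f, hfp, fun y hy => ?_, ?_⟩
  · exact (hf ⟨y, Submodule.mem_sup_left hy⟩).trans (hf₀Y y hy)
  · exact (hf ⟨x₀, Submodule.mem_sup_right (Submodule.mem_span_singleton_self x₀)⟩).trans hf₀x₀

theorem exists_strongDual_comp_eq {X Y : Type*} [AddCommGroup X] [Module 𝕜 X]
    [SeminormedAddCommGroup Y] [NormedSpace 𝕜 Y] (Φ : X →ₗ[𝕜] Y) (f : Module.Dual 𝕜 X) {C : ℝ}
    (hC : 0 ≤ C) (hf : ∀ x, ‖f x‖ ≤ C * ‖Φ x‖) :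
    ∃ g : StrongDual 𝕜 Y, ‖g‖ ≤ C ∧ ∀ x, g (Φ x) = f x := by
  have hker : f ∈ Φ.ker.dualAnnihilator := by
    refine (Submodule.mem_dualAnnihilator f).2 fun x hx => norm_le_zero_iff.1 ?_
    simpa [LinearMap.mem_ker.1 hx] using hf x
  obtain ⟨g₀, rfl⟩ := LinearMap.range_dualMap_eq_dualAnnihilator_ker Φ ▸ hker
  lift C to NNReal using hC
  obtain ⟨g, hg, hgC⟩ := Module.Dual.exists_extension_of_le_seminorm
    (p := C • normSeminorm 𝕜 Y) Φ.range (g₀.domRestrict _) (by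
      rintro ⟨_, x, rfl⟩
      exact hf x)
  exact ⟨g.mkContinuous C hgC, g.mkContinuous_norm_le C.2 hgC, fun x => hg ⟨Φ x, x, rfl⟩⟩

variable {E F : Type*} [NormedAddCommGroup E] [NormedSpace 𝕜 E] [NormedAddCommGroup F]
  [NormedSpace 𝕜 F]

theorem exists_norm_le_one_opNorm_le_mul (T : E →L[𝕜] F) {C : ℝ} (hC : 1 < C) :
    ∃ x, ‖x‖ ≤ 1 ∧ ‖T‖ ≤ C * ‖T x‖ := by
  rcases eq_or_ne T 0 with rfl | hT
  · exact ⟨0, by simp, by simp⟩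
  have hlt : ‖T‖ / C < ‖T‖ := div_lt_self (norm_pos_iff.2 hT) hC
  obtain ⟨x, hx, hTx⟩ := T.exists_lt_apply_of_lt_opNorm hlt
  exact ⟨x, hx.le, (div_le_iff₀' (zero_lt_one.trans hC)).1 hTx.le⟩

theorem sum_norm_comp_single_le {ι : Type*} [Fintype ι] [DecidableEq ι]
    (g : StrongDual 𝕜 (ι → E)) :
    ∑ i, ‖g ∘L ContinuousLinearMap.single 𝕜 (fun _ => E) i‖ ≤ ‖g‖ := by
  refine le_of_forall_one_lt_le_pow_mul 1 fun C hC => ?_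
  choose y hy hgy using fun i =>
    exists_norm_le_one_opNorm_le_mul (g ∘L ContinuousLinearMap.single 𝕜 (fun _ => E) i) hC
  choose u hu hgu using fun i => RCLike.exists_norm_eq_mul_self (g (Pi.single i (y i)))
  have huy : ‖fun i => u i • y i‖ ≤ 1 := (pi_norm_le_iff_of_nonneg zero_le_one).2 fun i => by
    rw [norm_smul, hu, one_mul]
    exact hy i
  have hsum : ((∑ i, ‖g (Pi.single i (y i))‖ : ℝ) : 𝕜) = g fun i => u i • y i := by
    rw [← Finset.univ_sum_single fun i => u i • y i, map_sum, RCLike.ofReal_sum]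
    simp only [hgu, Pi.single_smul, map_smul, smul_eq_mul]
  calc ∑ i, ‖g ∘L ContinuousLinearMap.single 𝕜 (fun _ => E) i‖
      ≤ ∑ i, C * ‖g (Pi.single i (y i))‖ := Finset.sum_le_sum fun i _ => hgy i
    _ = C * ∑ i, ‖g (Pi.single i (y i))‖ := by rw [Finset.mul_sum]
    _ ≤ C * ‖((∑ i, ‖g (Pi.single i (y i))‖ : ℝ) : 𝕜)‖ := by
      rw [RCLike.norm_ofReal]
      gcongr
      exact le_abs_self _
    _ ≤ C * (‖g‖ * 1) := by
      rw [hsum]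
      gcongr
      exact g.le_opNorm_of_le huy
    _ = C ^ 1 * ‖g‖ := by rw [mul_one, pow_one]

variable (𝕜 E F) in
theorem exists_finset_opNorm_le_mul [FiniteDimensional 𝕜 E] {C : ℝ} (hC : 1 < C) :
    ∃ t : Finset E, (∀ x ∈ t, ‖x‖ ≤ 1) ∧
      ∀ S : E →L[𝕜] F, ‖S‖ ≤ C * ‖fun x : t => S x‖ := by
  have hC₀ : 0 < C := zero_lt_one.trans hC
  have : ProperSpace E := FiniteDimensional.proper 𝕜 E
  obtain ⟨t, htB, htfin, hcov⟩ := (isCompact_closedBall (0 : E) 1).finite_cover_balls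
    (sub_pos.2 (inv_lt_one_of_one_lt₀ hC))
  lift t to Finset E using htfin
  refine ⟨t, fun x hx => by simpa using htB hx, fun S => ?_⟩
  have hself : ‖S‖ ≤ ‖fun x : t => S x‖ + ‖S‖ * (1 - C⁻¹) := by
    have hC₁ : 0 ≤ 1 - C⁻¹ := (sub_pos.2 (inv_lt_one_of_one_lt₀ hC)).le
    refine S.opNorm_le_of_unit_norm (by positivity) fun x hx => ?_
    obtain ⟨y, hy, hxy⟩ := Set.mem_iUnion₂.1 (hcov (mem_closedBall_zero_iff.2 hx.le))
    rw [Metric.mem_ball, dist_eq_norm] at hxy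
    calc ‖S x‖ = ‖S y + S (x - y)‖ := by rw [map_sub, add_sub_cancel]
      _ ≤ ‖S y‖ + ‖S (x - y)‖ := norm_add_le _ _
      _ ≤ _ := add_le_add (norm_le_pi_norm (fun x : t => S x) ⟨y, hy⟩) (S.le_opNorm_of_le hxy.le)
  have hinv : C⁻¹ * ‖S‖ ≤ ‖fun x : t => S x‖ := by linarith
  rwa [inv_mul_le_iff₀ hC₀] at hinv

theorem exists_finset_strongDual_norm_le_mul (H : Submodule 𝕜 E) [FiniteDimensional 𝕜 H] {C : ℝ}
    (hC : 1 < C) :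
    ∃ t : Finset (StrongDual 𝕜 E), (∀ φ ∈ t, ‖φ‖ ≤ 1) ∧
      ∀ y ∈ H, ‖y‖ ≤ C * ‖fun φ : t => (φ : StrongDual 𝕜 E) y‖ := by
  classical
  obtain ⟨t, ht, hnorm⟩ := exists_finset_opNorm_le_mul 𝕜 (StrongDual 𝕜 H) 𝕜 hC
  choose ext hext hextn using exists_extension_norm_eq (𝕜 := 𝕜) H
  refine ⟨t.image ext, fun φ hφ => ?_, fun y hy => ?_⟩
  · obtain ⟨ψ, hψ, rfl⟩ := Finset.mem_image.1 hφ
    exact (hextn ψ).trans_le (ht ψ hψ)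
  · calc ‖y‖ = ‖NormedSpace.inclusionInDoubleDualLi 𝕜 (E := H) ⟨y, hy⟩‖ :=
          ((NormedSpace.inclusionInDoubleDualLi 𝕜 (E := H)).norm_map ⟨y, hy⟩).symm
      _ ≤ C * ‖fun ψ : t => (ψ : StrongDual 𝕜 H) ⟨y, hy⟩‖ := hnorm _
      _ ≤ _ := by
        gcongr
        refine (pi_norm_le_iff_of_nonneg (norm_nonneg _)).2 fun ψ => ?_
        rw [← hext ψ ⟨y, hy⟩]
        exact norm_le_pi_norm (fun φ : t.image ext => (φ : StrongDual 𝕜 E) y)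
          ⟨ext ψ, Finset.mem_image_of_mem ext ψ.2⟩

end FunctionalAnalysis

section Trace

section

variable {𝕜 : Type*} [RCLike 𝕜] {M H F : Type*}
  [NormedAddCommGroup M] [NormedSpace 𝕜 M] [FiniteDimensional 𝕜 M]
  [NormedAddCommGroup H] [NormedSpace 𝕜 H] [FiniteDimensional 𝕜 H]
  [NormedAddCommGroup F] [NormedSpace 𝕜 F]

variable (𝕜 M) in
/-- The trace of operators on a finite-dimensional space, as a bounded functional: its operator
norm bounds the ideal norms below. -/
def traceCLM : (M →L[𝕜] M) →L[𝕜] 𝕜 :=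
  LinearMap.toContinuousLinearMap (LinearMap.trace 𝕜 M ∘ₗ ContinuousLinearMap.coeLM 𝕜)

theorem traceCLM_comp_comm (X : M →L[𝕜] H) (Y : H →L[𝕜] M) :
    traceCLM 𝕜 H (X ∘L Y) = traceCLM 𝕜 M (Y ∘L X) :=
  LinearMap.trace_comp_comm' (Y : H →ₗ[𝕜] M) (X : M →ₗ[𝕜] H)

theorem traceCLM_smulRight (a : StrongDual 𝕜 M) (x : M) :
    traceCLM 𝕜 M (ContinuousLinearMap.smulRight a x) = a x :=
  LinearMap.trace_smulRight (a : M →ₗ[𝕜] 𝕜) x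

variable (𝕜 M) in
/-- The coordinate functionals of the basis `Module.finBasis`, as bounded functionals. -/
def finCoord (i : Fin (Module.finrank 𝕜 M)) : StrongDual 𝕜 M :=
  LinearMap.toContinuousLinearMap ((Module.finBasis 𝕜 M).coord i)

theorem sum_finCoord_smul (x : M) : ∑ i, finCoord 𝕜 M i x • Module.finBasis 𝕜 M i = x :=
  (Module.finBasis 𝕜 M).sum_repr x

theorem sum_smulRight_finCoord_comp (V : F →L[𝕜] M) :
    ∑ i, ContinuousLinearMap.smulRight (finCoord 𝕜 M i ∘L V) (Module.finBasis 𝕜 M i) = V := by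
  ext y
  simpa using sum_finCoord_smul (𝕜 := 𝕜) (V y)

theorem sum_smulRight_finCoord (S : M →L[𝕜] F) :
    ∑ i, ContinuousLinearMap.smulRight (finCoord 𝕜 M i) (S (Module.finBasis 𝕜 M i)) = S := by
  ext x
  simpa using congrArg S (sum_finCoord_smul (𝕜 := 𝕜) x)

theorem exists_traceCLM_comp_eq (f : StrongDual 𝕜 (M →L[𝕜] F)) :
    ∃ V : F →L[𝕜] M, ∀ S, f S = traceCLM 𝕜 M (V ∘L S) := by
  let φ : Fin (Module.finrank 𝕜 M) → StrongDual 𝕜 F := fun i =>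
    f ∘L ContinuousLinearMap.smulRightL 𝕜 M F (finCoord 𝕜 M i)
  refine ⟨∑ i, ContinuousLinearMap.smulRight (φ i) (Module.finBasis 𝕜 M i), fun S => ?_⟩
  have hcomp : (∑ i, ContinuousLinearMap.smulRight (φ i) (Module.finBasis 𝕜 M i)) ∘L S =
      ∑ i, ContinuousLinearMap.smulRight (φ i ∘L S) (Module.finBasis 𝕜 M i) := by
    ext x
    simp
  calc f S = ∑ i, φ i (S (Module.finBasis 𝕜 M i)) := by
        rw [← sum_smulRight_finCoord S, map_sum, sum_smulRight_finCoord]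
        rfl
    _ = _ := by
        rw [hcomp, map_sum]
        exact Finset.sum_congr rfl fun i _ => (traceCLM_smulRight (φ i ∘L S) _).symm

/-- The second adjoint `F'' → M'' = M` of an operator `V : F → M` into a finite-dimensional
space. -/
def bidualExt (V : F →L[𝕜] M) : StrongDual 𝕜 (StrongDual 𝕜 F) →L[𝕜] M :=
  ∑ i, ContinuousLinearMap.smulRight
    (NormedSpace.inclusionInDoubleDual 𝕜 (StrongDual 𝕜 F) (finCoord 𝕜 M i ∘L V))
    (Module.finBasis 𝕜 M i)

theorem dual_bidualExt (V : F →L[𝕜] M) (z : StrongDual 𝕜 (StrongDual 𝕜 F))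
    (a : StrongDual 𝕜 M) : a (bidualExt V z) = z (a ∘L V) := by
  have haV : a ∘L V = ∑ i, a (Module.finBasis 𝕜 M i) • (finCoord 𝕜 M i ∘L V) := by
    ext y
    simpa [mul_comm] using congrArg a (sum_finCoord_smul (𝕜 := 𝕜) (V y)).symm
  rw [haV]
  simp [bidualExt, mul_comm]

theorem eq_bidualExt_iff (V : F →L[𝕜] M) (z : StrongDual 𝕜 (StrongDual 𝕜 F)) (x : M) :
    x = bidualExt V z ↔ ∀ a : StrongDual 𝕜 M, a x = z (a ∘L V) := by
  rw [SeparatingDual.eq_iff_forall_dual_eq (R := 𝕜)]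
  simp only [dual_bidualExt]

theorem bidualExt_inclusionInDoubleDual (V : F →L[𝕜] M) (y : F) :
    bidualExt V (NormedSpace.inclusionInDoubleDual 𝕜 F y) = V y :=
  ((eq_bidualExt_iff V _ _).2 fun _ => rfl).symm

theorem bidualExt_comp (P : M →L[𝕜] H) (V : F →L[𝕜] M) :
    bidualExt (P ∘L V) = P ∘L bidualExt V := by
  ext z
  exact ((eq_bidualExt_iff _ z _).2 fun a => dual_bidualExt V z (a ∘L P)).symm

end

section

variable {𝕜 : Type} [RCLike 𝕜] {E F G : Type u}
  [NormedAddCommGroup E] [NormedSpace 𝕜 E]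
  [NormedAddCommGroup F] [NormedSpace 𝕜 F]
  [NormedAddCommGroup G] [NormedSpace 𝕜 G]

namespace FiniteRank

theorem of_finiteDimensional_domain [FiniteDimensional 𝕜 E] (T : E →L[𝕜] F) : FiniteRank T :=
  inferInstanceAs (FiniteDimensional 𝕜 (LinearMap.range (T : E →ₗ[𝕜] F)))

theorem comp_left {S : E →L[𝕜] F} (hS : FiniteRank S) (R : F →L[𝕜] G) : FiniteRank (R ∘L S) := by
  unfold FiniteRank at *
  rw [ContinuousLinearMap.toLinearMap_comp, LinearMap.range_comp]
  infer_instance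

theorem comp_right {S : F →L[𝕜] G} (hS : FiniteRank S) (R : E →L[𝕜] F) : FiniteRank (S ∘L R) := by
  unfold FiniteRank at *
  rw [ContinuousLinearMap.toLinearMap_comp]
  exact Submodule.finiteDimensional_of_le (LinearMap.range_comp_le_range _ _)

theorem exists_factorization {T : E →L[𝕜] F} (hT : FiniteRank T) :
    ∃ (K : Submodule 𝕜 F) (_ : FiniteDimensional 𝕜 K) (T₀ : E →L[𝕜] K),
      T = K.subtypeL ∘L T₀ ∧ ‖T₀‖ ≤ ‖T‖ :=
  ⟨_, hT, T.codRestrict _ fun x => ⟨x, rfl⟩, rfl,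
    ContinuousLinearMap.opNorm_le_bound _ (norm_nonneg _) fun x => T.le_opNorm x⟩

end FiniteRank

theorem finTrace_comp_eq_traceCLM {M : Type*} [NormedAddCommGroup M] [NormedSpace 𝕜 M]
    [FiniteDimensional 𝕜 M] (X : M →L[𝕜] F) (Y : F →L[𝕜] M) :
    finTrace (X ∘L Y) = traceCLM 𝕜 M (Y ∘L X) := by
  set K := LinearMap.range ((X ∘L Y : F →L[𝕜] F) : F →ₗ[𝕜] F)
  set L := LinearMap.range (X : M →ₗ[𝕜] F)
  have hKL : K ≤ L := LinearMap.range_comp_le_range (Y : F →ₗ[𝕜] M) (X : M →ₗ[𝕜] F)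
  have : FiniteDimensional 𝕜 K := Submodule.finiteDimensional_of_le hKL
  calc finTrace (X ∘L Y)
      = LinearMap.trace 𝕜 L (Submodule.inclusion hKL ∘ₗ
          ((X ∘L Y : F →L[𝕜] F) : F →ₗ[𝕜] F).rangeRestrict ∘ₗ L.subtype) :=
        LinearMap.trace_comp_comm' (Submodule.inclusion hKL)
          (((X ∘L Y : F →L[𝕜] F) : F →ₗ[𝕜] F).rangeRestrict ∘ₗ L.subtype)
    _ = traceCLM 𝕜 M (Y ∘L X) :=
        (LinearMap.trace_comp_comm' (X : M →ₗ[𝕜] F).rangeRestrict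
          ((Y : F →ₗ[𝕜] M) ∘ₗ L.subtype)).symm

theorem finTrace_smulRight (a : StrongDual 𝕜 F) (y : F) :
    finTrace (ContinuousLinearMap.smulRight a y) = a y := by
  calc finTrace (ContinuousLinearMap.smulRight a y)
      = finTrace (ContinuousLinearMap.smulRight (1 : StrongDual 𝕜 𝕜) y ∘L a) := rfl
    _ = traceCLM 𝕜 𝕜 (ContinuousLinearMap.smulRight (1 : StrongDual 𝕜 𝕜) (a y)) := by
        rw [finTrace_comp_eq_traceCLM]
        congr 1
        ext
        simp
    _ = a y := traceCLM_smulRight 1 (a y)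

namespace FiniteRank

theorem smulRight (a : StrongDual 𝕜 E) (y : F) :
    FiniteRank (ContinuousLinearMap.smulRight a y) :=
  Submodule.finiteDimensional_of_le (S₂ := 𝕜 ∙ y) <| by
    rintro _ ⟨x, rfl⟩
    exact Submodule.smul_mem _ _ (Submodule.mem_span_singleton_self y)

theorem exists_finTrace_comp_eq {X : F →L[𝕜] E} (hX : FiniteRank X) :
    ∃ tr : (E →L[𝕜] F) →ₗ[𝕜] 𝕜, ∀ T, finTrace (T ∘L X) = tr T := by
  obtain ⟨K, _, X₀, rfl, -⟩ := hX.exists_factorization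
  exact ⟨{ toFun := fun T => traceCLM 𝕜 K (X₀ ∘L T ∘L K.subtypeL)
           map_add' := fun S T => by simp
           map_smul' := fun c T => by simp },
    fun T => finTrace_comp_eq_traceCLM (T ∘L K.subtypeL) X₀⟩

theorem finTrace_comp_comm {X : E →L[𝕜] F} (hX : FiniteRank X) (Y : F →L[𝕜] E) :
    finTrace (X ∘L Y) = finTrace (Y ∘L X) := by
  obtain ⟨K, _, X₀, rfl, -⟩ := hX.exists_factorization
  exact (finTrace_comp_eq_traceCLM K.subtypeL (X₀ ∘L Y)).trans
    (finTrace_comp_eq_traceCLM (Y ∘L K.subtypeL) X₀).symm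

end FiniteRank

end

end Trace

section LocalReflexivity

variable {𝕜 : Type*} [RCLike 𝕜] {M F : Type*}
  [NormedAddCommGroup M] [NormedSpace 𝕜 M] [NormedAddCommGroup F] [NormedSpace 𝕜 F]

/-- `S : M → F` is a local substitute for `T : M → F''`: it agrees with `T` on the functionals of
`N`, and wherever `T` takes its values in the canonical image of `F`. -/
def IsLocalLift (N : Submodule 𝕜 (StrongDual 𝕜 F))
    (T : M →L[𝕜] StrongDual 𝕜 (StrongDual 𝕜 F)) (S : M →L[𝕜] F) : Prop :=
  (∀ x, ∀ b ∈ N, b (S x) = T x b) ∧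
    ∀ x, T x ∈ Set.range (NormedSpace.inclusionInDoubleDual 𝕜 F) →
      NormedSpace.inclusionInDoubleDual 𝕜 F (S x) = T x

theorem mem_of_forall_eq_zero (N : Submodule 𝕜 (StrongDual 𝕜 F)) [FiniteDimensional 𝕜 N]
    {ψ : StrongDual 𝕜 F} (h : ∀ y, (∀ b ∈ N, b y = 0) → ψ y = 0) : ψ ∈ N := by
  set N' : Submodule 𝕜 (Module.Dual 𝕜 F) := N.map (ContinuousLinearMap.coeLM 𝕜)
  have hmem : (ψ : F →ₗ[𝕜] 𝕜) ∈ N'.dualCoannihilator.dualAnnihilator :=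
    (Submodule.mem_dualAnnihilator _).2 fun y hy => h y fun b hb =>
      (Submodule.mem_dualCoannihilator y).1 hy _ (Submodule.mem_map_of_mem hb)
  rw [Subspace.dualCoannihilator_dualAnnihilator_eq] at hmem
  obtain ⟨b, hb, hbψ⟩ := hmem
  rwa [← ContinuousLinearMap.coe_injective hbψ]

/-- An algebraic retraction `k` of `F''` onto `F` is corrected, through a right inverse `ρ` of the
evaluation map `e : F → Dual N`, so as to become compatible with the functionals of `N`. -/
theorem exists_retraction_bidual (N : Submodule 𝕜 (StrongDual 𝕜 F)) [FiniteDimensional 𝕜 N] :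
    ∃ κ : StrongDual 𝕜 (StrongDual 𝕜 F) →ₗ[𝕜] F,
      (∀ y, κ (NormedSpace.inclusionInDoubleDual 𝕜 F y) = y) ∧ ∀ z, ∀ b ∈ N, b (κ z) = z b := by
  set j : F →ₗ[𝕜] StrongDual 𝕜 (StrongDual 𝕜 F) :=
    (NormedSpace.inclusionInDoubleDual 𝕜 F).toLinearMap
  have hj : Function.Injective j := (NormedSpace.inclusionInDoubleDualLi 𝕜 (E := F)).injective
  obtain ⟨k, hk⟩ := j.exists_leftInverse_of_injective (LinearMap.ker_eq_bot.2 hj)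
  let B : N →ₗ[𝕜] Module.Dual 𝕜 F := ContinuousLinearMap.coeLM 𝕜 ∘ₗ N.subtype
  have hB : Function.Injective B :=
    ContinuousLinearMap.coe_injective.comp Subtype.coe_injective
  obtain ⟨ρ, hρ⟩ := B.flip.exists_rightInverse_of_surjective
    (LinearMap.range_eq_top.2 (LinearMap.flip_surjective_iff₁.2 hB))
  let res : StrongDual 𝕜 (StrongDual 𝕜 F) →ₗ[𝕜] Module.Dual 𝕜 N :=
    LinearMap.lcomp 𝕜 𝕜 N.subtype ∘ₗ ContinuousLinearMap.coeLM 𝕜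
  have hkj : ∀ y, k (j y) = y := LinearMap.congr_fun hk
  refine ⟨k + ρ ∘ₗ (res - B.flip ∘ₗ k), fun y => ?_, fun z b hb => ?_⟩
  · have hres : res (j y) = B.flip y := rfl
    change k (j y) + ρ (res (j y) - B.flip (k (j y))) = y
    rw [hkj, hres, sub_self, map_zero, add_zero]
  · have hbρ : b (ρ (res z - B.flip (k z))) = z b - b (k z) :=
      LinearMap.congr_fun (LinearMap.congr_fun hρ (res z - B.flip (k z))) ⟨b, hb⟩
    change b (k z + ρ (res z - B.flip (k z))) = z b
    rw [map_add, hbρ, add_sub_cancel]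

variable [FiniteDimensional 𝕜 M]

theorem exists_isLocalLift (N : Submodule 𝕜 (StrongDual 𝕜 F)) [FiniteDimensional 𝕜 N]
    (T : M →L[𝕜] StrongDual 𝕜 (StrongDual 𝕜 F)) : ∃ S, IsLocalLift N T S := by
  obtain ⟨κ, hκj, hκN⟩ := exists_retraction_bidual N
  refine ⟨LinearMap.toContinuousLinearMap
    (κ ∘ₗ (T : M →ₗ[𝕜] StrongDual 𝕜 (StrongDual 𝕜 F))), fun x => hκN (T x), ?_⟩
  rintro x ⟨y, hy⟩
  change NormedSpace.inclusionInDoubleDual 𝕜 F (κ (T x)) = T x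
  rw [← hy, hκj]

/-- The operators `S : M → F` which vanish on `M₀` and are annihilated by the functionals of `N`:
adding one of them to a local lift of `T` gives a local lift again, if `M₀` is where `T` takes its
values in `F`. -/
def localKernel (M₀ : Submodule 𝕜 M) (N : Submodule 𝕜 (StrongDual 𝕜 F)) :
    Submodule 𝕜 (M →L[𝕜] F) where
  carrier := {S | (∀ x ∈ M₀, S x = 0) ∧ ∀ x, ∀ b ∈ N, b (S x) = 0}
  zero_mem' := ⟨fun _ _ => rfl, fun _ b _ => map_zero b⟩
  add_mem' := fun {S S'} hS hS' =>
    ⟨fun x hx => by simp [hS.1 x hx, hS'.1 x hx],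
      fun x b hb => by simp [hS.2 x b hb, hS'.2 x b hb]⟩
  smul_mem' := fun a S hS =>
    ⟨fun x hx => by simp [hS.1 x hx], fun x b hb => by simp [hS.2 x b hb]⟩

/-- If `P` is a projection with kernel `M₀`, then `D = D P`, and the functionals `a P V` lie in
`N`, because `V` kills the rank one members of `localKernel M₀ N`. -/
theorem traceCLM_bidualExt_comp_eq_zero {M₀ : Submodule 𝕜 M} {N : Submodule 𝕜 (StrongDual 𝕜 F)}
    [FiniteDimensional 𝕜 N] {V : F →L[𝕜] M}
    (hV : ∀ S ∈ localKernel M₀ N, traceCLM 𝕜 M (V ∘L S) = 0)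
    {D : M →L[𝕜] StrongDual 𝕜 (StrongDual 𝕜 F)} (hDM₀ : ∀ x ∈ M₀, D x = 0)
    (hDN : ∀ x, ∀ b ∈ N, D x b = 0) : traceCLM 𝕜 M (bidualExt V ∘L D) = 0 := by
  obtain ⟨M₁, hM⟩ := Submodule.exists_isCompl M₀
  set P : M →L[𝕜] M := LinearMap.toContinuousLinearMap (M₁.projection M₀ hM.symm)
  have hPM₀ : ∀ x ∈ M₀, P x = 0 := fun x hx =>
    (Submodule.projection_apply_eq_zero_iff hM.symm).2 hx
  have hDP : D = D ∘L P := by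
    ext1 x
    have hx : D (x - P x) = 0 := hDM₀ _ (Submodule.sub_projection_mem hM.symm x)
    rwa [map_sub, sub_eq_zero] at hx
  have hPV : ∀ a : StrongDual 𝕜 M, a ∘L P ∘L V ∈ N := fun a =>
    mem_of_forall_eq_zero N fun y hy => by
      have hmem : ContinuousLinearMap.smulRight (a ∘L P) y ∈ localKernel M₀ N :=
        ⟨fun x hx => by simp [hPM₀ x hx], fun x b hb => by simp [hy b hb]⟩
      have hcomp : V ∘L ContinuousLinearMap.smulRight (a ∘L P) y =
          ContinuousLinearMap.smulRight (a ∘L P) (V y) := by ext; simp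
      have htr := hV _ hmem
      rwa [hcomp, traceCLM_smulRight] at htr
  have hzero : bidualExt (P ∘L V) ∘L D = 0 := by
    ext x
    exact ((eq_bidualExt_iff _ (D x) 0).2 fun a => by
      rw [map_zero, hDN x _ (hPV a)]).symm
  rw [hDP, ← ContinuousLinearMap.comp_assoc, traceCLM_comp_comm,
    ← ContinuousLinearMap.comp_assoc, ← bidualExt_comp, hzero, map_zero]

theorem exists_isLocalLift_seminorm_lt (p : Seminorm 𝕜 (M →L[𝕜] F)) {K : ℝ}
    (hp : ∀ S, p S ≤ K * ‖S‖) (N : Submodule 𝕜 (StrongDual 𝕜 F)) [FiniteDimensional 𝕜 N]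
    (T : M →L[𝕜] StrongDual 𝕜 (StrongDual 𝕜 F)) {c c' : ℝ} (hc : c < c')
    (hT : ∀ V : F →L[𝕜] M, (∀ S, ‖traceCLM 𝕜 M (V ∘L S)‖ ≤ p S) →
      ‖traceCLM 𝕜 M (bidualExt V ∘L T)‖ ≤ c) :
    ∃ S, p S < c' ∧ IsLocalLift N T S := by
  set j := NormedSpace.inclusionInDoubleDual 𝕜 F
  obtain ⟨S₀, hS₀N, hS₀j⟩ := exists_isLocalLift N T
  let M₀ : Submodule 𝕜 M := j.range.comap T.toLinearMap
  by_contra! hS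
  have hlift : ∀ R ∈ localKernel M₀ N, c' ≤ p (S₀ + R) := fun R hR => by
    refine not_lt.1 fun hlt => hS _ hlt ⟨fun x b hb => ?_, fun x hx => ?_⟩
    · rw [add_apply, map_add, hR.2 x b hb, add_zero, hS₀N x b hb]
    · rw [add_apply, hR.1 x hx, add_zero, hS₀j x hx]
  have hc' : 0 < c' := by
    refine ((norm_nonneg _).trans (hT 0 fun S => ?_)).trans_lt hc
    simp
  obtain ⟨f, hfp, hfY, hfS₀⟩ := exists_dual_eq_of_forall_le_seminorm_add p _ S₀ hc'.le hlift
  obtain ⟨V, hV⟩ := exists_traceCLM_comp_eq (f.mkContinuous K fun S => (hfp S).trans (hp S))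
  replace hV : ∀ S, f S = traceCLM 𝕜 M (V ∘L S) := hV
  have hD : traceCLM 𝕜 M (bidualExt V ∘L (T - j ∘L S₀)) = 0 :=
    traceCLM_bidualExt_comp_eq_zero (fun S hS => hV S ▸ hfY S hS)
      (fun x hx => sub_eq_zero.2 (hS₀j x hx).symm)
      (fun x b hb => sub_eq_zero.2 (hS₀N x b hb).symm)
  have hT₀ : bidualExt V ∘L T = V ∘L S₀ + bidualExt V ∘L (T - j ∘L S₀) := by
    ext1 x
    simp [j, bidualExt_inclusionInDoubleDual]
  have hTV := hT V fun S => hV S ▸ hfp S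
  rw [hT₀, map_add, hD, add_zero, ← hV, hfS₀, RCLike.norm_ofReal, abs_of_pos hc'] at hTV
  exact hc.not_ge hTV

/-- The dual of the operator norm on `L(M, F)` is the nuclear norm on `L(F, M)`. -/
theorem exists_nuclear_representation {V : F →L[𝕜] M}
    (hV : ∀ S, ‖traceCLM 𝕜 M (V ∘L S)‖ ≤ ‖S‖) {C : ℝ} (hC : 1 < C) :
    ∃ (t : Finset M) (φ : t → StrongDual 𝕜 F), (∀ x ∈ t, ‖x‖ ≤ 1) ∧ ∑ x, ‖φ x‖ ≤ C ∧
      V = ∑ x, ContinuousLinearMap.smulRight (φ x) (x : M) := by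
  classical
  have hC₀ : 0 ≤ C := (zero_lt_one.trans hC).le
  obtain ⟨t, ht, hnorm⟩ := exists_finset_opNorm_le_mul 𝕜 M F hC
  let Φ : (M →L[𝕜] F) →ₗ[𝕜] t → F :=
    LinearMap.pi fun x => (ContinuousLinearMap.apply 𝕜 F (x : M)).toLinearMap
  let f : Module.Dual 𝕜 (M →L[𝕜] F) :=
    (traceCLM 𝕜 M ∘L ContinuousLinearMap.compL 𝕜 M F M V).toLinearMap
  obtain ⟨g, hgC, hg⟩ := exists_strongDual_comp_eq Φ f hC₀ fun S => (hV S).trans (hnorm S)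
  refine ⟨t, fun x => g ∘L ContinuousLinearMap.single 𝕜 (fun _ => F) x, ht,
    (sum_norm_comp_single_le g).trans hgC, ?_⟩
  ext y
  refine (SeparatingDual.eq_iff_forall_dual_eq (R := 𝕜)).2 fun a => ?_
  have hcomp : V ∘L ContinuousLinearMap.smulRight a y = ContinuousLinearMap.smulRight a (V y) := by
    ext
    simp
  calc a (V y) = g fun x : t => a x • y := by
        rw [← traceCLM_smulRight, ← hcomp]
        exact (hg (ContinuousLinearMap.smulRight a y)).symm
    _ = ∑ x : t, g (Pi.single x (a x • y)) := by
        rw [← map_sum, Finset.univ_sum_single fun x : t => a x • y]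
    _ = _ := by simp [Pi.single_smul, mul_comm]

theorem norm_traceCLM_bidualExt_comp_le {V : F →L[𝕜] M}
    (hV : ∀ S, ‖traceCLM 𝕜 M (V ∘L S)‖ ≤ ‖S‖) (T : M →L[𝕜] StrongDual 𝕜 (StrongDual 𝕜 F)) :
    ‖traceCLM 𝕜 M (bidualExt V ∘L T)‖ ≤ ‖T‖ := by
  refine le_of_forall_one_lt_le_pow_mul 1 fun C hC => ?_
  obtain ⟨t, φ, ht, hφ, rfl⟩ := exists_nuclear_representation hV hC
  have hcomp : bidualExt (∑ x, ContinuousLinearMap.smulRight (φ x) (x : M)) ∘L T =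
      ∑ x, ContinuousLinearMap.smulRight (ContinuousLinearMap.apply 𝕜 𝕜 (φ x) ∘L T) (x : M) := by
    ext x
    refine ((eq_bidualExt_iff _ (T x) _).2 fun a => ?_).symm
    have ha : a ∘L ∑ x, ContinuousLinearMap.smulRight (φ x) (x : M) = ∑ x : t, a x • φ x := by
      ext y
      simp [mul_comm]
    rw [ha]
    simp [mul_comm]
  rw [hcomp, map_sum]
  simp only [traceCLM_smulRight]
  calc ‖∑ x : t, T x (φ x)‖ ≤ ∑ x : t, ‖T‖ * ‖φ x‖ := norm_sum_le_of_le _ fun x _ =>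
        (T x).le_of_opNorm_le (by simpa using T.le_opNorm_of_le (ht x x.2)) (φ x)
    _ = ‖T‖ * ∑ x, ‖φ x‖ := by rw [Finset.mul_sum]
    _ ≤ ‖T‖ * C := by gcongr
    _ = C ^ 1 * ‖T‖ := by rw [pow_one, mul_comm]

theorem exists_isLocalLift_norm_lt (N : Submodule 𝕜 (StrongDual 𝕜 F)) [FiniteDimensional 𝕜 N]
    {T : M →L[𝕜] StrongDual 𝕜 (StrongDual 𝕜 F)} {c : ℝ} (hT : ‖T‖ < c) :
    ∃ S : M →L[𝕜] F, ‖S‖ < c ∧ IsLocalLift N T S :=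
  exists_isLocalLift_seminorm_lt (normSeminorm 𝕜 (M →L[𝕜] F)) (K := 1)
    (fun S => (one_mul ‖S‖).ge) N T hT fun _ hV => norm_traceCLM_bidualExt_comp_le hV T

end LocalReflexivity

namespace OpClass

section Adjoint

variable {𝕜 : Type} [RCLike 𝕜] {A : OpClass.{u} 𝕜} {E F : Type u}
  [NormedAddCommGroup E] [NormedSpace 𝕜 E] [NormedAddCommGroup F] [NormedSpace 𝕜 F]

theorem bddBelow_adjointConstants (T : E →L[𝕜] F) : BddBelow (A.adjointConstants T) :=
  ⟨0, fun _ hc => hc.1⟩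

theorem add_mem_adjointConstants {S T : E →L[𝕜] F} {c d : ℝ} (hc : c ∈ A.adjointConstants S)
    (hd : d ∈ A.adjointConstants T) : c + d ∈ A.adjointConstants (S + T) := by
  refine ⟨add_nonneg hc.1 hd.1, fun E₀ F₀ _ _ _ _ _ _ B W R hB hW hR => ?_⟩
  obtain ⟨tr, htr⟩ := (hB.comp_right (W ∘L R)).exists_finTrace_comp_eq (F := F)
  have hS := hc.2 E₀ F₀ B W R hB hW hR
  have hT := hd.2 E₀ F₀ B W R hB hW hR
  rw [htr] at hS hT ⊢
  calc ‖tr (S + T)‖ ≤ ‖tr S‖ + ‖tr T‖ := map_add tr S T ▸ norm_add_le _ _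
    _ ≤ _ := add_le_add hS hT
    _ = _ := by ring

theorem norm_mul_mem_adjointConstants_smul (a : 𝕜) {T : E →L[𝕜] F} {c : ℝ}
    (hc : c ∈ A.adjointConstants T) : ‖a‖ * c ∈ A.adjointConstants (a • T) := by
  refine ⟨mul_nonneg (norm_nonneg a) hc.1, fun E₀ F₀ _ _ _ _ _ _ B W R hB hW hR => ?_⟩
  obtain ⟨tr, htr⟩ := (hB.comp_right (W ∘L R)).exists_finTrace_comp_eq (F := F)
  have hT := hc.2 E₀ F₀ B W R hB hW hR
  rw [htr] at hT ⊢
  calc ‖tr (a • T)‖ = ‖a‖ * ‖tr T‖ := by rw [map_smul, norm_smul]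
    _ ≤ ‖a‖ * (c * ‖B‖ * A.norm W * ‖R‖) := by gcongr
    _ = _ := by ring

theorem IsBanachIdeal.opNorm_le_of_mem_adjointConstants [CompleteSpace E] (hA : A.IsBanachIdeal)
    {T : E →L[𝕜] F} {c : ℝ} (hc : c ∈ A.adjointConstants T) : ‖T‖ ≤ c := by
  refine T.opNorm_le_of_unit_norm hc.1 fun x hx => ?_
  obtain ⟨a, ha, hax⟩ := exists_dual_vector 𝕜 x (by simp [hx])
  obtain ⟨b, hb, hbT⟩ := exists_dual_vector'' 𝕜 (T x)
  have hcomp : T ∘L ContinuousLinearMap.smulRight a x ∘L ContinuousLinearMap.smulRight a x ∘L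
      ContinuousLinearMap.smulRight b x = ContinuousLinearMap.smulRight b (T x) := by
    ext
    simp [hax, hx]
  have htr := hc.2 E E (ContinuousLinearMap.smulRight a x) (ContinuousLinearMap.smulRight a x)
    (ContinuousLinearMap.smulRight b x) (.smulRight a x) (hA.rankOne_mem a x) (.smulRight b x)
  rw [hcomp, finTrace_smulRight, hbT, RCLike.norm_ofReal, abs_norm, hA.norm_rankOne,
    ContinuousLinearMap.norm_smulRight_apply, ContinuousLinearMap.norm_smulRight_apply,
    ha, hx] at htr
  exact htr.trans (by simpa using mul_le_of_le_one_right hc.1 hb)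

variable [CompleteSpace E] [CompleteSpace F]

theorem adjoint_norm_nonneg (T : E →L[𝕜] F) : 0 ≤ A.adjoint.norm T :=
  Real.sInf_nonneg fun _ hc => hc.1

theorem adjoint_norm_le {T : E →L[𝕜] F} {c : ℝ} (hc : c ∈ A.adjointConstants T) :
    A.adjoint.norm T ≤ c :=
  csInf_le (bddBelow_adjointConstants T) hc

theorem adjoint_norm_mem_adjointConstants {T : E →L[𝕜] F} (hT : A.adjoint.mem T) :
    A.adjoint.norm T ∈ A.adjointConstants T := by
  obtain ⟨c, -, hlim, hc⟩ := exists_seq_tendsto_sInf hT (bddBelow_adjointConstants T)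
  refine ⟨adjoint_norm_nonneg T, fun E₀ F₀ _ _ _ _ _ _ B W R hB hW hR => ?_⟩
  exact ge_of_tendsto (((hlim.mul_const _).mul_const _).mul_const _)
    (.of_forall fun n => (hc n).2 E₀ F₀ B W R hB hW hR)

/-- The cyclicity of the trace exchanges the roles of the two operators: `A ⊆ A**`. -/
theorem norm_mem_adjointConstants_adjoint {T : E →L[𝕜] F} (hT : A.mem T) (hT₀ : 0 ≤ A.norm T) :
    A.norm T ∈ A.adjoint.adjointConstants T := by
  refine ⟨hT₀, fun E₀ F₀ _ _ _ _ _ _ B W R hB hW hR => ?_⟩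
  calc ‖finTrace (T ∘L B ∘L W ∘L R)‖ = ‖finTrace (W ∘L R ∘L T ∘L B)‖ :=
        congrArg _ ((hB.comp_left T).finTrace_comp_comm (W ∘L R))
    _ ≤ A.adjoint.norm W * ‖R‖ * A.norm T * ‖B‖ :=
        (adjoint_norm_mem_adjointConstants hW).2 F E R T B hR hT hB
    _ = _ := by ring

end Adjoint

namespace IsBanachIdeal

section

variable {𝕜 : Type} [RCLike 𝕜] {A : OpClass.{u} 𝕜} {E F G : Type u}
  [NormedAddCommGroup E] [NormedSpace 𝕜 E] [CompleteSpace E]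
  [NormedAddCommGroup F] [NormedSpace 𝕜 F] [CompleteSpace F]
  [NormedAddCommGroup G] [NormedSpace 𝕜 G] [CompleteSpace G]

theorem zero_mem (hA : A.IsBanachIdeal) : A.mem (0 : E →L[𝕜] F) := by
  simpa using hA.rankOne_mem (0 : StrongDual 𝕜 E) (0 : F)

theorem norm_zero (hA : A.IsBanachIdeal) : A.norm (0 : E →L[𝕜] F) = 0 := by
  simpa using hA.norm_rankOne (0 : StrongDual 𝕜 E) (0 : F)

theorem norm_nonneg (hA : A.IsBanachIdeal) {S : E →L[𝕜] F} (hS : A.mem S) : 0 ≤ A.norm S := by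
  have hadd := hA.norm_add_le S ((-1 : 𝕜) • S) hS (hA.smul_mem _ _ hS)
  rw [hA.norm_smul _ _ hS] at hadd
  simp only [neg_smul, one_smul, add_neg_cancel, hA.norm_zero, norm_neg, norm_one, one_mul] at hadd
  linarith

theorem norm_comp_right_le (hA : A.IsBanachIdeal) {S : F →L[𝕜] G} (hS : A.mem S)
    (T : E →L[𝕜] F) : A.norm (S ∘L T) ≤ A.norm S * ‖T‖ := by
  have hS₀ := hA.norm_nonneg hS
  calc A.norm (S ∘L T) ≤ ‖ContinuousLinearMap.id 𝕜 G‖ * A.norm S * ‖T‖ :=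
        hA.norm_comp_le (ContinuousLinearMap.id 𝕜 G) S T hS
    _ ≤ 1 * A.norm S * ‖T‖ := by
        gcongr
        exact ContinuousLinearMap.norm_id_le
    _ = _ := by rw [one_mul]

theorem norm_comp_left_le (hA : A.IsBanachIdeal) {S : E →L[𝕜] F} (hS : A.mem S)
    (R : F →L[𝕜] G) : A.norm (R ∘L S) ≤ ‖R‖ * A.norm S := by
  have hS₀ := hA.norm_nonneg hS
  calc A.norm (R ∘L S) ≤ ‖R‖ * A.norm S * ‖ContinuousLinearMap.id 𝕜 E‖ :=
        hA.norm_comp_le R S (ContinuousLinearMap.id 𝕜 E) hS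
    _ ≤ ‖R‖ * A.norm S * 1 := by
        gcongr
        exact ContinuousLinearMap.norm_id_le
    _ = _ := by rw [mul_one]

theorem opNorm_le (hA : A.IsBanachIdeal) {S : E →L[𝕜] F} (hS : A.mem S) : ‖S‖ ≤ A.norm S := by
  refine S.opNorm_le_of_unit_norm (hA.norm_nonneg hS) fun x hx => ?_
  obtain ⟨a, ha, -⟩ := exists_dual_vector 𝕜 x (by simp [hx])
  have hcomp : S ∘L ContinuousLinearMap.smulRight a x = ContinuousLinearMap.smulRight a (S x) := by
    ext
    simp
  calc ‖S x‖ = A.norm (S ∘L ContinuousLinearMap.smulRight a x) := by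
        rw [hcomp, hA.norm_rankOne, ha, one_mul]
    _ ≤ A.norm S * ‖ContinuousLinearMap.smulRight a x‖ := hA.norm_comp_right_le hS _
    _ = A.norm S := by
        rw [ContinuousLinearMap.norm_smulRight_apply, ha, hx, one_mul, mul_one]

theorem sum_mem_and_norm_sum_le (hA : A.IsBanachIdeal) {ι : Type*} (s : Finset ι)
    {S : ι → E →L[𝕜] F} (hS : ∀ i ∈ s, A.mem (S i)) :
    A.mem (∑ i ∈ s, S i) ∧ A.norm (∑ i ∈ s, S i) ≤ ∑ i ∈ s, A.norm (S i) := by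
  classical
  induction s using Finset.induction_on with
  | empty => exact ⟨hA.zero_mem, hA.norm_zero.le⟩
  | insert i s hi ih =>
    obtain ⟨hmem, hnorm⟩ := ih fun k hk => hS k (Finset.mem_insert_of_mem hk)
    have hSi := hS i (Finset.mem_insert_self i s)
    rw [Finset.sum_insert hi, Finset.sum_insert hi]
    exact ⟨hA.add_mem _ _ hSi hmem, (hA.norm_add_le _ _ hSi hmem).trans (by gcongr)⟩

theorem adjoint_norm_le_adjoint_adjoint_adjoint_norm (hA : A.IsBanachIdeal) {T : E →L[𝕜] F}
    (hT : A.adjoint.mem T) : A.adjoint.norm T ≤ A.adjoint.adjoint.adjoint.norm T := by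
  have hT' : A.adjoint.adjoint.adjoint.mem T :=
    ⟨_, norm_mem_adjointConstants_adjoint hT (adjoint_norm_nonneg T)⟩
  refine adjoint_norm_le ⟨adjoint_norm_nonneg T, fun E₀ F₀ _ _ _ _ _ _ B W R hB hW hR => ?_⟩
  have hW' := norm_mem_adjointConstants_adjoint hW (hA.norm_nonneg hW)
  have hT₀ := adjoint_norm_nonneg (A := A.adjoint.adjoint) T
  calc ‖finTrace (T ∘L B ∘L W ∘L R)‖
      ≤ A.adjoint.adjoint.adjoint.norm T * ‖B‖ * A.adjoint.adjoint.norm W * ‖R‖ :=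
        (adjoint_norm_mem_adjointConstants hT').2 E₀ F₀ B W R hB ⟨_, hW'⟩ hR
    _ ≤ A.adjoint.adjoint.adjoint.norm T * ‖B‖ * A.norm W * ‖R‖ := by
        gcongr
        exact adjoint_norm_le hW'

theorem adjoint_norm_comp_le (hA : A.IsBanachIdeal) (R : F →L[𝕜] G) {T : E →L[𝕜] F}
    (hT : A.adjoint.mem T) : A.adjoint.norm (R ∘L T) ≤ ‖R‖ * A.adjoint.norm T := by
  have hT₀ := adjoint_norm_nonneg (A := A) T
  refine adjoint_norm_le ⟨by positivity, fun E₀ F₀ _ _ _ _ _ _ B W Q hB hW hQ => ?_⟩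
  have hW₀ := hA.norm_nonneg hW
  calc ‖finTrace ((R ∘L T) ∘L B ∘L W ∘L Q)‖ = ‖finTrace (T ∘L B ∘L W ∘L Q ∘L R)‖ :=
        congrArg _ ((hQ.comp_left (T ∘L B ∘L W)).finTrace_comp_comm R).symm
    _ ≤ A.adjoint.norm T * ‖B‖ * A.norm W * ‖Q ∘L R‖ :=
        (adjoint_norm_mem_adjointConstants hT).2 E₀ F₀ B W (Q ∘L R) hB hW (hQ.comp_right R)
    _ ≤ A.adjoint.norm T * ‖B‖ * A.norm W * (‖Q‖ * ‖R‖) := by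
        gcongr
        exact Q.opNorm_comp_le R
    _ = _ := by ring

end

section FiniteDimensional

variable {𝕜 : Type} [RCLike 𝕜] {A : OpClass.{u} 𝕜} {M F : Type u}
  [NormedAddCommGroup M] [NormedSpace 𝕜 M] [FiniteDimensional 𝕜 M]
  [NormedAddCommGroup F] [NormedSpace 𝕜 F]

theorem norm_traceCLM_mul_mem_adjointConstants (hA : A.IsBanachIdeal) (S : M →L[𝕜] F) :
    ‖traceCLM 𝕜 M‖ * ‖S‖ ∈ A.adjointConstants S := by
  refine ⟨by positivity, fun E₀ F₀ _ _ _ _ _ _ B W R _ hW _ => ?_⟩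
  calc ‖finTrace (S ∘L B ∘L W ∘L R)‖ = ‖traceCLM 𝕜 M ((B ∘L W ∘L R) ∘L S)‖ :=
        congrArg _ (finTrace_comp_eq_traceCLM S (B ∘L W ∘L R))
    _ ≤ ‖traceCLM 𝕜 M‖ * (‖B‖ * (‖W‖ * ‖R‖) * ‖S‖) := by
        refine (traceCLM 𝕜 M).le_opNorm_of_le ?_
        refine (ContinuousLinearMap.opNorm_comp_le _ _).trans ?_
        gcongr
        refine (ContinuousLinearMap.opNorm_comp_le _ _).trans ?_
        gcongr
        exact ContinuousLinearMap.opNorm_comp_le _ _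
    _ ≤ ‖traceCLM 𝕜 M‖ * (‖B‖ * (A.norm W * ‖R‖) * ‖S‖) := by
        gcongr
        exact hA.opNorm_le hW
    _ = _ := by ring

variable [CompleteSpace M] [CompleteSpace F]

theorem adjoint_mem_of_finiteDimensional (hA : A.IsBanachIdeal) (S : M →L[𝕜] F) :
    A.adjoint.mem S :=
  ⟨_, hA.norm_traceCLM_mul_mem_adjointConstants S⟩

variable (M F) in
/-- The adjoint norm on the operators out of a finite-dimensional space, all of which belong to
the adjoint ideal. -/
def adjointSeminorm (hA : A.IsBanachIdeal) : Seminorm 𝕜 (M →L[𝕜] F) :=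
  Seminorm.ofSMulLE (fun S => A.adjoint.norm S)
    (le_antisymm
      ((adjoint_norm_le (hA.norm_traceCLM_mul_mem_adjointConstants 0)).trans_eq (by simp))
      (adjoint_norm_nonneg 0))
    (fun S T => adjoint_norm_le (add_mem_adjointConstants
      (adjoint_norm_mem_adjointConstants (hA.adjoint_mem_of_finiteDimensional S))
      (adjoint_norm_mem_adjointConstants (hA.adjoint_mem_of_finiteDimensional T))))
    (fun a S => adjoint_norm_le (norm_mul_mem_adjointConstants_smul a
      (adjoint_norm_mem_adjointConstants (hA.adjoint_mem_of_finiteDimensional S))))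

theorem mem_of_finiteDimensional (hA : A.IsBanachIdeal) (V : F →L[𝕜] M) : A.mem V := by
  rw [← sum_smulRight_finCoord_comp V]
  exact (hA.sum_mem_and_norm_sum_le _ fun i _ => hA.rankOne_mem _ _).1

/-- The ideal norm on the operators into a finite-dimensional space, all of which belong to the
ideal. -/
def normSeminorm (hA : A.IsBanachIdeal) : Seminorm 𝕜 (F →L[𝕜] M) :=
  Seminorm.of (fun V => A.norm V)
    (fun V W => hA.norm_add_le V W (hA.mem_of_finiteDimensional V) (hA.mem_of_finiteDimensional W))
    (fun a V => hA.norm_smul a V (hA.mem_of_finiteDimensional V))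

theorem exists_norm_le_mul_opNorm (hA : A.IsBanachIdeal) :
    ∃ K : ℝ, ∀ V : F →L[𝕜] M, A.norm V ≤ K * ‖V‖ := by
  refine ⟨∑ i, ‖finCoord 𝕜 M i‖ * ‖Module.finBasis 𝕜 M i‖, fun V => ?_⟩
  calc A.norm V
      = A.norm (∑ i, ContinuousLinearMap.smulRight (finCoord 𝕜 M i ∘L V)
          (Module.finBasis 𝕜 M i)) := by rw [sum_smulRight_finCoord_comp]
    _ ≤ ∑ i, A.norm (ContinuousLinearMap.smulRight (finCoord 𝕜 M i ∘L V)
          (Module.finBasis 𝕜 M i)) :=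
        (hA.sum_mem_and_norm_sum_le _ fun i _ => hA.rankOne_mem _ _).2
    _ ≤ ∑ i, ‖finCoord 𝕜 M i‖ * ‖V‖ * ‖Module.finBasis 𝕜 M i‖ := by
        refine Finset.sum_le_sum fun i _ => ?_
        rw [hA.norm_rankOne]
        gcongr
        exact ContinuousLinearMap.opNorm_comp_le _ _
    _ = _ := by simp only [Finset.sum_mul, mul_right_comm]

theorem continuous_norm (hA : A.IsBanachIdeal) : Continuous fun V : F →L[𝕜] M => A.norm V := by
  obtain ⟨K, hK⟩ := hA.exists_norm_le_mul_opNorm (M := M) (F := F)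
  exact Seminorm.continuous_of_le (p := hA.normSeminorm)
    (q := K.toNNReal • _root_.normSeminorm 𝕜 (F →L[𝕜] M))
    (continuous_const.mul _root_.continuous_norm)
    fun V => (hK V).trans
      (mul_le_mul_of_nonneg_right (Real.le_coe_toNNReal K) (_root_.norm_nonneg V))

/-- With `f` a Hahn–Banach functional normed at `W`, the operator representing `f` has adjoint norm
at most `1`. -/
theorem norm_le_one_of_forall_norm_traceCLM_le {H : Type u} [NormedAddCommGroup H] [NormedSpace 𝕜 H]
    [CompleteSpace H] [FiniteDimensional 𝕜 H] (hA : A.IsBanachIdeal) {W : H →L[𝕜] M}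
    (hW : ∀ S : M →L[𝕜] H, ‖traceCLM 𝕜 M (W ∘L S)‖ ≤ A.adjoint.norm S) : A.norm W ≤ 1 := by
  have hW₀ := hA.norm_nonneg (hA.mem_of_finiteDimensional W)
  obtain ⟨f, hfA, -, hfW⟩ := exists_dual_eq_of_forall_le_seminorm_add hA.normSeminorm ⊥ W hW₀
    (fun X hX => by rw [(Submodule.mem_bot 𝕜).1 hX, add_zero]; exact le_rfl)
  obtain ⟨K, hK⟩ := hA.exists_norm_le_mul_opNorm (M := M) (F := H)
  obtain ⟨S, hS⟩ := exists_traceCLM_comp_eq (f.mkContinuous K fun X => (hfA X).trans (hK X))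
  replace hS : ∀ X, f X = traceCLM 𝕜 M (X ∘L S) := fun X => (hS X).trans (traceCLM_comp_comm S X)
  have hS₁ : (1 : ℝ) ∈ A.adjointConstants S :=
    ⟨zero_le_one, fun E₀ F₀ _ _ _ _ _ _ B X R _ hX _ => by
      rw [finTrace_comp_eq_traceCLM, ← hS, one_mul]
      exact (hfA _).trans (hA.norm_comp_le B X R hX)⟩
  calc A.norm W = ‖f W‖ := by rw [hfW, RCLike.norm_ofReal, abs_of_nonneg hW₀]
    _ = ‖traceCLM 𝕜 M (W ∘L S)‖ := by rw [hS]
    _ ≤ A.adjoint.norm S := hW S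
    _ ≤ 1 := adjoint_norm_le hS₁

end FiniteDimensional

end IsBanachIdeal

section Maximal

variable {𝕜 : Type} [RCLike 𝕜] {A : OpClass.{u} 𝕜} {D M F : Type u}
  [NormedAddCommGroup D] [NormedSpace 𝕜 D] [CompleteSpace D]
  [NormedAddCommGroup M] [NormedSpace 𝕜 M] [CompleteSpace M] [FiniteDimensional 𝕜 M]
  [NormedAddCommGroup F] [NormedSpace 𝕜 F] [CompleteSpace F]

theorem IsBanachIdeal.norm_comp_le_of_approximable (hA : A.IsBanachIdeal) {V : F →L[𝕜] M} {c : ℝ}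
    (hV : ∀ (H : Submodule 𝕜 F) [FiniteDimensional 𝕜 H] [CompleteSpace H],
      A.norm (V ∘L H.subtypeL) ≤ c)
    {Q : D →L[𝕜] F} (hQ : (approximable 𝕜).mem Q) : A.norm (V ∘L Q) ≤ c * ‖Q‖ := by
  have hfin : {Q : D →L[𝕜] F | FiniteRank Q} ⊆ {Q | A.norm (V ∘L Q) ≤ c * ‖Q‖} := fun Q hQ => by
    obtain ⟨H, _, Q₀, rfl, hQ₀⟩ := FiniteRank.exists_factorization hQ
    have : CompleteSpace H := FiniteDimensional.complete 𝕜 H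
    have hVH := hA.mem_of_finiteDimensional (V ∘L H.subtypeL)
    exact (hA.norm_comp_right_le hVH Q₀).trans
      (mul_le_mul (hV H) hQ₀ (_root_.norm_nonneg _) ((hA.norm_nonneg hVH).trans (hV H)))
  have hclosed : IsClosed {Q : D →L[𝕜] F | A.norm (V ∘L Q) ≤ c * ‖Q‖} :=
    isClosed_le (hA.continuous_norm.comp (continuous_const.clm_comp continuous_id))
      (continuous_const.mul _root_.continuous_norm)
  exact closure_minimal hfin hclosed hQ

theorem IsMaximal.norm_le_of_forall_finiteDimensional (hmax : A.IsMaximal) (hA : A.IsBanachIdeal)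
    {V : F →L[𝕜] M} {c : ℝ}
    (hV : ∀ (H : Submodule 𝕜 F) [FiniteDimensional 𝕜 H] [CompleteSpace H],
      A.norm (V ∘L H.subtypeL) ≤ c) : A.norm V ≤ c := by
  have hc : 0 ≤ c := (hA.norm_nonneg (hA.mem_of_finiteDimensional _)).trans (hV ⊥)
  rw [(hmax V).2 (hA.mem_of_finiteDimensional V)]
  refine Real.sSup_le ?_ hc
  rintro _ ⟨G, _, _, _, R, -, hR, rfl⟩
  refine Real.sSup_le ?_ hc
  rintro _ ⟨D, _, _, _, Q, hQ, hQ₁, rfl⟩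
  calc A.norm (R ∘L V ∘L Q) ≤ ‖R‖ * A.norm (V ∘L Q) :=
        hA.norm_comp_left_le (hA.mem_of_finiteDimensional _) R
    _ ≤ ‖R‖ * (c * ‖Q‖) := by gcongr; exact hA.norm_comp_le_of_approximable hV hQ
    _ = c := by
        rw [show ‖R‖ = 1 from hR, show ‖Q‖ = 1 from hQ₁, one_mul, mul_one]

theorem IsMaximal.norm_le_one_of_forall_norm_traceCLM_le (hmax : A.IsMaximal)
    (hA : A.IsBanachIdeal) {V : F →L[𝕜] M}
    (hV : ∀ S : M →L[𝕜] F, ‖traceCLM 𝕜 M (V ∘L S)‖ ≤ A.adjoint.norm S) : A.norm V ≤ 1 := by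
  refine hmax.norm_le_of_forall_finiteDimensional hA fun H _ _ =>
    hA.norm_le_one_of_forall_norm_traceCLM_le fun S => ?_
  calc ‖traceCLM 𝕜 M (V ∘L H.subtypeL ∘L S)‖ ≤ A.adjoint.norm (H.subtypeL ∘L S) := hV _
    _ ≤ ‖H.subtypeL‖ * A.adjoint.norm S :=
        hA.adjoint_norm_comp_le _ (hA.adjoint_mem_of_finiteDimensional S)
    _ ≤ A.adjoint.norm S := mul_le_of_le_one_left (adjoint_norm_nonneg S) H.norm_subtypeL_le

end Maximal

section Extension

variable {𝕜 : Type} [RCLike 𝕜] {A : OpClass.{u} 𝕜} {M F : Type u}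
  [NormedAddCommGroup M] [NormedSpace 𝕜 M] [CompleteSpace M] [FiniteDimensional 𝕜 M]
  [NormedAddCommGroup F] [NormedSpace 𝕜 F]

/-- Evaluation at finitely many functionals embeds `H` almost isometrically into a finite power
of the scalar field; the extension property is applied to this embedding. -/
theorem HasExtensionProperty.exists_factorization_comp_subtypeL (hEP : A.HasExtensionProperty)
    (hA : A.IsBanachIdeal) {H : Submodule 𝕜 F} [FiniteDimensional 𝕜 H] [CompleteSpace H]
    (U : H →L[𝕜] M) {C : ℝ} (hC : 1 < C) :
    ∃ (t : Finset (StrongDual 𝕜 F)) (R : F →L[𝕜] t → 𝕜) (W : (t → 𝕜) →L[𝕜] M),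
      ‖R‖ ≤ 1 ∧ A.norm W ≤ C ^ 2 * A.norm U ∧ U = W ∘L R ∘L H.subtypeL := by
  have hU := hA.mem_of_finiteDimensional U
  obtain ⟨t, ht, hnorm⟩ := exists_finset_strongDual_norm_le_mul H hC
  set R : F →L[𝕜] t → 𝕜 := ContinuousLinearMap.pi fun φ : t => (φ : StrongDual 𝕜 F)
  have hR : ‖R‖ ≤ 1 := ContinuousLinearMap.norm_pi_le_of_le (fun φ : t => ht φ φ.2) zero_le_one
  set r : H →ₗ[𝕜] t → 𝕜 := (R ∘L H.subtypeL).toLinearMap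
  have hr : Function.Injective r := (injective_iff_map_eq_zero r).2 fun y hy => by
    have hy' := hnorm y y.2
    rw [show (fun φ : t => (φ : StrongDual 𝕜 F) y) = 0 from hy, _root_.norm_zero, mul_zero] at hy'
    exact norm_le_zero_iff.1 hy'
  let e : H ≃ₗ[𝕜] r.range := LinearEquiv.ofInjective r hr
  have : CompleteSpace r.range := FiniteDimensional.complete 𝕜 _
  let L : r.range →L[𝕜] H := LinearMap.toContinuousLinearMap e.symm.toLinearMap
  have hL : ‖L‖ ≤ C := L.opNorm_le_bound (zero_lt_one.trans hC).le fun z => by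
    obtain ⟨y, rfl⟩ := e.surjective z
    rw [show L (e y) = y from e.symm_apply_apply y]
    exact hnorm y y.2
  obtain ⟨W, -, hUW, hW⟩ := hEP (C - 1) (sub_pos.2 hC) _ _ _ r.range.subtypeₗᵢ (U ∘L L)
    (hA.mem_of_finiteDimensional _)
  refine ⟨t, R, W, hR, ?_, ?_⟩
  · calc A.norm W ≤ (1 + (C - 1)) * A.norm (U ∘L L) := hW
      _ ≤ (1 + (C - 1)) * (A.norm U * C) := by
        have := hA.norm_nonneg hU
        gcongr
        exact (hA.norm_comp_right_le hU L).trans (by gcongr)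
      _ = C ^ 2 * A.norm U := by ring
  · ext1 y
    have hy : U (L (e y)) = W (R y) := DFunLike.congr_fun hUW (e y)
    rwa [show L (e y) = y from e.symm_apply_apply y] at hy

variable [CompleteSpace F]

theorem HasExtensionProperty.norm_traceCLM_comp_le (hEP : A.HasExtensionProperty)
    (hA : A.IsBanachIdeal) {H : Submodule 𝕜 F} [FiniteDimensional 𝕜 H] [CompleteSpace H]
    (U : H →L[𝕜] M) (T : M →L[𝕜] H) :
    ‖traceCLM 𝕜 M (U ∘L T)‖ ≤ A.adjoint.norm (H.subtypeL ∘L T) * A.norm U := by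
  refine le_of_forall_one_lt_le_pow_mul 2 fun C hC => ?_
  obtain ⟨t, R, W, hR, hW, hUW⟩ := hEP.exists_factorization_comp_subtypeL hA U hC
  have hT₀ := adjoint_norm_nonneg (A := A) (H.subtypeL ∘L T)
  have hWmem := hA.mem_of_finiteDimensional W
  have hW₀ := hA.norm_nonneg hWmem
  have hU₀ := hA.norm_nonneg (hA.mem_of_finiteDimensional U)
  have hT := adjoint_norm_mem_adjointConstants
    (hA.adjoint_mem_of_finiteDimensional (H.subtypeL ∘L T))
  have hid : ‖ContinuousLinearMap.id 𝕜 M‖ ≤ 1 := ContinuousLinearMap.norm_id_le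
  calc ‖traceCLM 𝕜 M (U ∘L T)‖
      = ‖finTrace ((H.subtypeL ∘L T) ∘L ContinuousLinearMap.id 𝕜 M ∘L W ∘L R)‖ := by
        rw [finTrace_comp_eq_traceCLM, hUW]
        rfl
    _ ≤ A.adjoint.norm (H.subtypeL ∘L T) * ‖ContinuousLinearMap.id 𝕜 M‖ * A.norm W * ‖R‖ :=
        hT.2 M (t → 𝕜) _ W R (.of_finiteDimensional_domain _) hWmem
          ((FiniteRank.of_finiteDimensional_domain (.id 𝕜 (t → 𝕜))).comp_right R)
    _ ≤ A.adjoint.norm (H.subtypeL ∘L T) * 1 * (C ^ 2 * A.norm U) * 1 := by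
        gcongr
    _ = _ := by ring

theorem HasExtensionProperty.norm_traceCLM_bidualExt_comp_le (hEP : A.HasExtensionProperty)
    (hA : A.IsBanachIdeal) (U : F →L[𝕜] M) (T : M →L[𝕜] StrongDual 𝕜 (StrongDual 𝕜 F)) :
    ‖traceCLM 𝕜 M (bidualExt U ∘L T)‖ ≤ A.adjoint.norm T * A.norm U := by
  refine le_of_forall_one_lt_le_pow_mul 1 fun C hC => ?_
  have hU := hA.mem_of_finiteDimensional U
  have hT₀ := adjoint_norm_nonneg (A := A) T
  obtain ⟨H, _, T₀, hT, -⟩ := (FiniteRank.of_finiteDimensional_domain T).exists_factorization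
  have : CompleteSpace H := FiniteDimensional.complete 𝕜 H
  let N : Submodule 𝕜 (StrongDual 𝕜 F) :=
    ((ContinuousLinearMap.compL 𝕜 F M 𝕜).flip U).toLinearMap.range
  obtain ⟨L, hL, hLN, -⟩ := exists_isLocalLift_norm_lt N (H.norm_subtypeL_le.trans_lt hC)
  have hUL : U ∘L L = bidualExt U ∘L H.subtypeL := by
    ext1 z
    exact (eq_bidualExt_iff U (z : StrongDual 𝕜 (StrongDual 𝕜 F)) _).2 fun a =>
      hLN z (a ∘L U) ⟨a, rfl⟩
  calc ‖traceCLM 𝕜 M (bidualExt U ∘L T)‖ = ‖traceCLM 𝕜 M ((U ∘L L) ∘L T₀)‖ := by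
        rw [hUL, hT, ContinuousLinearMap.comp_assoc]
    _ ≤ A.adjoint.norm T * A.norm (U ∘L L) :=
        (hEP.norm_traceCLM_comp_le hA (U ∘L L) T₀).trans_eq (by rw [← hT])
    _ ≤ A.adjoint.norm T * (A.norm U * C) := by
        have := hA.norm_nonneg hU
        gcongr
        exact (hA.norm_comp_right_le hU L).trans (by gcongr)
    _ = C ^ 1 * (A.adjoint.norm T * A.norm U) := by ring

end Extension

theorem adjoint_localReflexivityWith_adjoint {𝕜 : Type} [RCLike 𝕜] {A : OpClass.{u} 𝕜}
    (hA : A.IsBanachIdeal) (hmax : A.IsMaximal) (hEP : A.HasExtensionProperty) :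
    A.adjoint.LocalReflexivityWith A.adjoint := by
  intro M F _ _ _ _ _ _ _ N _ T ε hε
  have hT := adjoint_norm_mem_adjointConstants (hA.adjoint_mem_of_finiteDimensional T)
  rcases (adjoint_norm_nonneg (A := A) T).eq_or_lt with hT₀ | hT₀
  · obtain rfl : T = 0 := norm_le_zero_iff.1 (hT₀ ▸ hA.opNorm_le_of_mem_adjointConstants hT)
    refine ⟨0, hA.adjoint_mem_of_finiteDimensional 0, ?_,
      fun _ b _ => map_zero b, fun _ _ => map_zero _⟩
    rw [← hT₀, mul_zero]
    exact (map_zero (hA.adjointSeminorm M F)).le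
  · obtain ⟨S, hS, hSN, hSj⟩ := exists_isLocalLift_seminorm_lt (hA.adjointSeminorm M F)
      (fun S => adjoint_norm_le (hA.norm_traceCLM_mul_mem_adjointConstants S)) N T
      (c := A.adjoint.norm T) (c' := (1 + ε) * A.adjoint.norm T)
      (lt_mul_of_one_lt_left hT₀ (lt_add_of_pos_right 1 hε)) fun V hV =>
        (hEP.norm_traceCLM_bidualExt_comp_le hA V T).trans
          (mul_le_of_le_one_right hT₀.le (hmax.norm_le_one_of_forall_norm_traceCLM_le hA hV))
    exact ⟨S, hA.adjoint_mem_of_finiteDimensional S, hS.le, hSN, hSj⟩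

end OpClass

end

theorem corollary4p1 {𝕜 : Type} [RCLike 𝕜] (A : OpClass.{u} 𝕜)
    (hA : A.IsBanachIdeal) (hmax : A.IsMaximal) (hEP : A.HasExtensionProperty) :
    A.adjoint.LRP ∧ A.adjoint.LocalReflexivityWith A.adjoint := by
  have h := OpClass.adjoint_localReflexivityWith_adjoint hA hmax hEP
  refine ⟨fun M F _ _ _ _ _ _ _ N _ T ε hε => ?_, h⟩
  obtain ⟨S, hS, hSn, hSNj⟩ := h M F N T ε hε
  refine ⟨S, hS, hSn.trans ?_, hSNj⟩
  gcongr
  exact hA.adjoint_norm_le_adjoint_adjoint_adjoint_norm (hA.adjoint_mem_of_finiteDimensional T)
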